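/- Let $d\ge 0$ and let $P\subset\mathbb{R}^d$ be a lattice $d$-polytope, i.e. the convex hull of finitely many points of $\mathbb{Z}^d$, with affine hull $\mathbb{R}^d$. Let $\partial P$ be its boundary. Put $L_{\partial P}(m)=|\partial(mP)\cap\mathbb{Z}^d|$ for $m\ge 1$, and let $h^\ast_{\partial P}(z)$ be defined by $$1+\sum_{m\ge 1}L_{\partial P}(m)\,z^m=\frac{h^\ast_{\partial P}(z)}{(1-z)^d}.$$ Let $\Delta$ be a regular unimodular triangulation of $\partial P$, in the following sense. * *Triangulation:* $\Delta$ is a finite geometric simplicial complex with vertices in $\mathbb{Z}^d$ whose simplices have union $\partial P$. * *Unimodular:* every $(d-1)$-simplex $\sigma$ of $\Delta$ has normalized volume $1$, i.e. the differences of its vertices generate the group of all integer vectors parallel to the affine hull of $\sigma$. * *Regular:* there is a weight function $\omega:\partial P\cap\mathbb{Z}^d\to\mathbb{R}$ such that, for every facet $F$ of $P$, the simplices of $\Delta$ contained in $F$ are exactly the projections to $\mathbb{R}^d$ of the nonempty lower faces of $\operatorname{conv}\{(a,\omega(a)) : a\in F\cap\mathbb{Z}^d\}\subset\mathbb{R}^{d+1}$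 (a lower face is the set of points at which a linear functional of the form $(x,t)\mapsto \ell(x)+t$ is minimal). Let $$h_\Delta(z)=\sum_{k=-1}^{\dim\Delta}f_k(\Delta)\,z^{k+1}(1-z)^{\dim\Delta-k}$$ be the $h$-polynomial of $\Delta$, where $f_{-1}(\Delta)=1$ and $f_k(\Delta)$ is the number of $k$-dimensional simplices of $\Delta$. Then $$h^\ast_{\partial P}(z)=h_\Delta(z).$$ In particular, $h^\ast_{\partial P}(z)$ is a polynomial. -/

import Mathlib

open scoped Pointwise

namespace BoundaryEhrhart

noncomputable section

/-- The integer lattice `ℤ^d`, as a subgroup of `ℝ^d`. -/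
def integerLattice (d : ℕ) : AddSubgroup (Fin d → ℝ) :=
  AddSubgroup.pi Set.univ fun _ => (Int.castAddHom ℝ).range

/-- `P` is a lattice polytope: the convex hull of finitely many points of `ℤ^d`. -/
def IsLatticePolytope {d : ℕ} (P : Set (Fin d → ℝ)) : Prop :=
  ∃ V : Finset (Fin d → ℝ), (V : Set (Fin d → ℝ)) ⊆ integerLattice d ∧
    P = convexHull ℝ (V : Set (Fin d → ℝ))

/-- `P` is a lattice `d`-polytope in `ℝ^d`: a lattice polytope whose affine hull is `ℝ^d`. -/
structure IsFullDimLatticePolytope {d : ℕ} (P : Set (Fin d → ℝ)) : Prop where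
  lattice : IsLatticePolytope P
  affineSpan_eq_top : affineSpan ℝ P = ⊤

/-- The facets of a polytope `P ⊆ ℝ^d`: its `(d-1)`-dimensional faces. -/
structure IsFacet {d : ℕ} (P F : Set (Fin d → ℝ)) : Prop where
  exposed : IsExposed ℝ P F
  nonempty : F.Nonempty
  dim : Module.finrank ℝ (vectorSpan ℝ F) + 1 = d

/-! ### The boundary Ehrhart series and the boundary `h^*`-polynomial -/

/-- `L_{∂P}(m) = |∂(mP) ∩ ℤ^d|`. -/
def boundaryCount {d : ℕ} (P : Set (Fin d → ℝ)) (m : ℕ) : ℕ :=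
  (frontier ((m : ℝ) • P) ∩ (integerLattice d : Set (Fin d → ℝ))).ncard

/-- `Ehr_{∂P}(z) = 1 + ∑_{m ≥ 1} L_{∂P}(m) z^m`. -/
def boundaryEhrhartSeries {d : ℕ} (P : Set (Fin d → ℝ)) : PowerSeries ℤ :=
  PowerSeries.mk fun m => if m = 0 then 1 else (boundaryCount P m : ℤ)

/-- The numerator `h^*_{∂P}(z)` in `Ehr_{∂P}(z) = h^*_{∂P}(z) / (1 - z)^d`, as a formal power
series. That it is a polynomial is not part of the definition. -/
def boundaryHStar {d : ℕ} (P : Set (Fin d → ℝ)) : PowerSeries ℤ :=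
  (1 - PowerSeries.X) ^ d * boundaryEhrhartSeries P

/-! ### The `h`-polynomial of a simplicial complex -/

/-- The number of faces with `i` vertices, that is `f_{i-1}`, with `f_{-1} = 1`.
(The empty face is not recorded in `Geometry.SimplicialComplex`.) -/
def faceCount {d : ℕ} (K : Geometry.SimplicialComplex ℝ (Fin d → ℝ)) (i : ℕ) : ℕ :=
  if i = 0 then 1 else {σ ∈ K.faces | σ.card = i}.ncard

/-- `dim K + 1`, the largest number of vertices of a face of the finite complex `K`. -/
def dimSucc {d : ℕ} (K : Geometry.SimplicialComplex ℝ (Fin d → ℝ)) : ℕ :=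
  sSup (Finset.card '' K.faces)

/-- `h_K(z) = ∑_{k = -1}^{dim K} f_k z^{k+1} (1 - z)^{dim K - k}`, written with `i = k + 1`. -/
def hPolynomial {d : ℕ} (K : Geometry.SimplicialComplex ℝ (Fin d → ℝ)) : Polynomial ℤ :=
  ∑ i ∈ Finset.range (dimSucc K + 1),
    (faceCount K i : Polynomial ℤ) * Polynomial.X ^ i * (1 - Polynomial.X) ^ (dimSucc K - i)

/-! ### Regular unimodular triangulations of the boundary -/

/-- `K` is a (lattice) triangulation of `∂P`: a finite geometric simplicial complex with vertices
in `ℤ^d` whose simplices cover exactly `∂P`. -/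
structure IsBoundaryTriangulation {d : ℕ} (P : Set (Fin d → ℝ))
    (K : Geometry.SimplicialComplex ℝ (Fin d → ℝ)) : Prop where
  finite : K.faces.Finite
  lattice : ∀ σ ∈ K.faces, (σ : Set (Fin d → ℝ)) ⊆ integerLattice d
  space_eq : K.space = frontier P

/-- The subgroup generated by the edge vectors of a simplex with vertex set `σ`. -/
def edgeLattice {d : ℕ} (σ : Finset (Fin d → ℝ)) : AddSubgroup (Fin d → ℝ) :=
  AddSubgroup.closure {x | ∃ v ∈ σ, ∃ w ∈ σ, x = v - w}

/-- The integer vectors parallel to the affine hull of `σ`. -/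
def parallelLattice {d : ℕ} (σ : Finset (Fin d → ℝ)) : AddSubgroup (Fin d → ℝ) :=
  integerLattice d ⊓ (vectorSpan ℝ (σ : Set (Fin d → ℝ))).toAddSubgroup

/-- The normalized volume of a lattice simplex with vertex set `σ` with respect to the lattice of
its affine hull: the index of its edge lattice in the lattice of parallel integer vectors. -/
def normalizedVolume {d : ℕ} (σ : Finset (Fin d → ℝ)) : ℕ :=
  (edgeLattice σ).relIndex (parallelLattice σ)

/-- A triangulation of the boundary of a `d`-polytope is unimodular if each of its
`(d-1)`-simplices has normalized volume `1`. -/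
def IsUnimodularBoundary {d : ℕ} (K : Geometry.SimplicialComplex ℝ (Fin d → ℝ)) : Prop :=
  ∀ σ ∈ K.faces, σ.card = d → normalizedVolume σ = 1

/-- The convex hull of the points `(a, ω a)`, `a ∈ A`. -/
def liftedPolytope {d : ℕ} (A : Set (Fin d → ℝ)) (ω : (Fin d → ℝ) → ℝ) :
    Set ((Fin d → ℝ) × ℝ) :=
  convexHull ℝ ((fun a => (a, ω a)) '' A)

/-- The lower face of `Q` at which `(x, t) ↦ ℓ x + t` is minimal, that is the face with outer
normal vector `(-ℓ, -1)`. -/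
def lowerFace {d : ℕ} (Q : Set ((Fin d → ℝ) × ℝ)) (ℓ : (Fin d → ℝ) →ₗ[ℝ] ℝ) :
    Set ((Fin d → ℝ) × ℝ) :=
  {p ∈ Q | ∀ q ∈ Q, ℓ p.1 + p.2 ≤ ℓ q.1 + q.2}

/-- The regular subdivision of `conv A` induced by the weights `ω a`, `a ∈ A`: the set of all
projections of lower faces (of every dimension) of the lifted polytope. -/
def regularSubdivision {d : ℕ} (A : Set (Fin d → ℝ)) (ω : (Fin d → ℝ) → ℝ) :
    Set (Set (Fin d → ℝ)) :=
  {C | ∃ ℓ : (Fin d → ℝ) →ₗ[ℝ] ℝ, C = Prod.fst '' lowerFace (liftedPolytope A ω) ℓ}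

/-- A triangulation `K` of `∂P` is regular if there are weights on the lattice points of `∂P` such
that, for every facet `F` of `P`, the restriction of `K` to `F` is the regular subdivision of `F`
induced by the weights of the lattice points of `F`. Only the values of `ω` at the lattice points of
`∂P` enter. -/
def IsRegularBoundary {d : ℕ} (P : Set (Fin d → ℝ))
    (K : Geometry.SimplicialComplex ℝ (Fin d → ℝ)) : Prop :=
  ∃ ω : (Fin d → ℝ) → ℝ, ∀ F, IsFacet P F →
    {C | ∃ σ ∈ K.faces, (σ : Set (Fin d → ℝ)) ⊆ F ∧ C = convexHull ℝ (σ : Set (Fin d → ℝ))} =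
      regularSubdivision (F ∩ (integerLattice d : Set (Fin d → ℝ))) ω

end

end BoundaryEhrhart

/-! Scale a lattice point of `∂(mP)` by `1/m`: it lies in the relative interior of exactly one face
`σ` of `Δ`. Unimodularity makes its barycentric coordinates, multiplied by `m`, positive integers
with sum `m`. Conversely every such choice gives a lattice point, so `σ` contributes `(z/(1-z))^|σ|`
to the Ehrhart series and the constant `1` stands for the empty face. Multiplying by `(1-z)^d` and
grouping faces by cardinality gives `h_Δ`.

Unimodularity is known only for faces with `d` vertices, so purity is needed: every boundary point
lies in such a face (`exists_large_face_mem`, `exists_facet_mem`). The bijection is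
`boundaryCount_eq_sum`; integrality is `exists_int_weights_of_unimodular`. -/

namespace BoundaryEhrhart

open Finset Topology

/-! ### Barycentric coordinates on affinely independent finite sets -/

section Barycentric

variable {E : Type*} [AddCommGroup E] [Module ℝ E]

/-- The common total is left arbitrary because the weights compared later sum to `m` rather than
`1`. -/
lemma eq_weights_of_affineIndependent {σ : Finset E}
    (hσ : AffineIndependent ℝ ((↑) : σ → E)) {w w' : E → ℝ}
    (hw : ∑ v ∈ σ, w v = ∑ v ∈ σ, w' v) (hx : ∑ v ∈ σ, w v • v = ∑ v ∈ σ, w' v • v) :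
    ∀ v ∈ σ, w v = w' v := by
  intro v hv
  have key := affineIndependent_iff.1 hσ Finset.univ (fun v => w v - w' v) ?_ ?_ ⟨v, hv⟩
    (Finset.mem_univ _)
  · exact sub_eq_zero.1 key
  · rw [Finset.sum_coe_sort σ (fun v => w v - w' v), Finset.sum_sub_distrib, hw, sub_self]
  · rw [Finset.sum_coe_sort σ (fun v => (w v - w' v) • v)]
    simp only [sub_smul]
    rw [Finset.sum_sub_distrib, hx, sub_self]

/-- A point with positive barycentric coordinates lies in no proper face of its simplex. -/
lemma subset_of_sum_smul_mem_convexHull [DecidableEq E] {σ ρ : Finset E}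
    (hσ : AffineIndependent ℝ ((↑) : σ → E)) (hρ : ρ ⊆ σ) {w : E → ℝ}
    (hpos : ∀ v ∈ σ, 0 < w v) (hsum : ∑ v ∈ σ, w v = 1)
    (hx : ∑ v ∈ σ, w v • v ∈ convexHull ℝ (ρ : Set E)) : σ ⊆ ρ := by
  obtain ⟨w', -, h1, h2⟩ := Finset.mem_convexHull'.1 hx
  intro v hv
  by_contra hvρ
  have h := eq_weights_of_affineIndependent hσ (w := w)
    (w' := fun v => if v ∈ ρ then w' v else 0) ?_ ?_ v hv
  · rw [if_neg hvρ] at h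
    exact (hpos v hv).ne' h
  · rw [hsum, ← Finset.sum_filter, Finset.filter_mem_eq_inter, Finset.inter_eq_right.2 hρ, h1]
  · simp only [ite_smul, zero_smul]
    rw [← Finset.sum_filter, Finset.filter_mem_eq_inter, Finset.inter_eq_right.2 hρ, h2]

/-- Every point of the space of a simplicial complex is in the relative interior of a face. -/
lemma exists_face_pos_weights (K : Geometry.SimplicialComplex ℝ E) {x : E} (hx : x ∈ K.space) :
    ∃ σ ∈ K.faces, ∃ w : E → ℝ, (∀ v ∈ σ, 0 < w v) ∧ ∑ v ∈ σ, w v = 1 ∧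
      ∑ v ∈ σ, w v • v = x := by
  classical
  obtain ⟨τ, hτ, hxτ⟩ := Geometry.SimplicialComplex.mem_space_iff.1 hx
  obtain ⟨w, h0, h1, h2⟩ := Finset.mem_convexHull'.1 hxτ
  have hsum : ∑ v ∈ τ with w v ≠ 0, w v = 1 := by rw [Finset.sum_filter_ne_zero, h1]
  refine ⟨τ.filter (fun v => w v ≠ 0), K.down_closed hτ (Finset.filter_subset _ _) ?_, w, ?_,
    hsum, ?_⟩
  · refine Finset.nonempty_of_sum_ne_zero (f := w) ?_
    rw [hsum]
    exact one_ne_zero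
  · intro v hv
    rw [Finset.mem_filter] at hv
    exact lt_of_le_of_ne (h0 v hv.1) hv.2.symm
  · rw [← h2]
    refine Finset.sum_subset (Finset.filter_subset _ _) fun v hv hv' => ?_
    have : w v = 0 := by
      by_contra h
      exact hv' (Finset.mem_filter.2 ⟨hv, h⟩)
    rw [this, zero_smul]

/-- A face containing a relative interior point of `σ` contains `σ`. -/
lemma face_subset_of_mem_convexHull (K : Geometry.SimplicialComplex ℝ E) {σ τ : Finset E}
    (hσ : σ ∈ K.faces) (hτ : τ ∈ K.faces) {w : E → ℝ} (hpos : ∀ v ∈ σ, 0 < w v)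
    (hsum : ∑ v ∈ σ, w v = 1) (hx : ∑ v ∈ σ, w v • v ∈ convexHull ℝ (τ : Set E)) : σ ⊆ τ := by
  classical
  have hxσ : ∑ v ∈ σ, w v • v ∈ convexHull ℝ (σ : Set E) :=
    Finset.mem_convexHull'.2 ⟨w, fun v hv => (hpos v hv).le, hsum, rfl⟩
  have hx' := K.inter_subset_convexHull hσ hτ ⟨hxσ, hx⟩
  rw [← Finset.coe_inter] at hx'
  exact (subset_of_sum_smul_mem_convexHull (K.indep hσ) Finset.inter_subset_left hpos hsum
    hx').trans Finset.inter_subset_right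

end Barycentric

/-! ### Purity of triangulations of the boundary of a convex body -/

section Purity

variable {E : Type*} [NormedAddCommGroup E] [NormedSpace ℝ E]

/-- The cone from an interior point over a neighbourhood of `x` in the boundary of a convex set
is a neighbourhood of `x`. -/
lemma eventually_mem_cone_frontier {P : Set E} (hP : Convex ℝ P) {p x : E}
    (hp : p ∈ interior P) (hx : x ∈ frontier P) {U : Set E} (hU : U ∈ 𝓝 x) :
    ∀ᶠ z in 𝓝 x, ∃ y ∈ U ∩ frontier P, ∃ t : ℝ, z = AffineMap.lineMap p y t := by
  set e : E ≃ₜ E := Homeomorph.addRight p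
  set Q : Set E := e ⁻¹' P with hQ
  have hQc : Convex ℝ Q := by
    simpa [hQ, e] using hP.translate_preimage_left p
  have hQ0 : Q ∈ 𝓝 (0 : E) := by
    refine e.continuous.continuousAt.preimage_mem_nhds ?_
    simpa [e] using mem_interior_iff_mem_nhds.1 hp
  have hfr : ∀ y, gauge Q (y - p) = 1 ↔ y ∈ frontier P := fun y => by
    rw [gauge_eq_one_iff_mem_frontier hQc hQ0, hQ, ← e.preimage_frontier]
    simp [e]
  -- The radial projection from `p` onto the frontier is continuous at `x` and fixes `x`, so it
  -- sends points near `x` into `U`.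
  have hg : Continuous fun z => gauge Q (z - p) :=
    (continuous_gauge hQc hQ0).comp (continuous_id.sub continuous_const)
  have hgx : gauge Q (x - p) = 1 := (hfr x).2 hx
  have hr : ContinuousAt (fun z => p + (gauge Q (z - p))⁻¹ • (z - p)) x := by
    refine continuousAt_const.add ((hg.continuousAt.inv₀ ?_).smul ?_)
    · rw [hgx]; exact one_ne_zero
    · exact continuousAt_id.sub continuousAt_const
  have hev : ∀ᶠ z in 𝓝 x, 0 < gauge Q (z - p) :=
    hg.continuousAt.eventually (lt_mem_nhds (hgx ▸ one_pos : 0 < gauge Q (x - p)))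
  have hUr : ∀ᶠ z in 𝓝 x, p + (gauge Q (z - p))⁻¹ • (z - p) ∈ U := by
    refine hr.eventually ?_
    simpa [hgx] using hU
  filter_upwards [hev, hUr] with z hz hzU
  refine ⟨_, ⟨hzU, (hfr _).1 ?_⟩, gauge Q (z - p), ?_⟩
  · rw [add_sub_cancel_left, gauge_smul_of_nonneg (inv_nonneg.2 hz.le), smul_eq_mul,
      inv_mul_cancel₀ hz.ne']
  · rw [AffineMap.lineMap_apply, vsub_eq_sub, add_sub_cancel_left, vadd_eq_add, smul_smul,
      mul_inv_cancel₀ hz.ne', one_smul, sub_add_cancel]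

lemma finrank_le_card_of_affineSpan_insert_eq_top {p : E} {τ : Finset E}
    (h : affineSpan ℝ (insert p (τ : Set E)) = ⊤) : Module.finrank ℝ E ≤ τ.card := by
  classical
  obtain ⟨k, hk⟩ : ∃ k, (insert p τ).card = k + 1 :=
    Nat.exists_eq_succ_of_ne_zero (Finset.card_ne_zero.2 (Finset.insert_nonempty _ _))
  have h1 := finrank_vectorSpan_image_finset_le ℝ (id : E → E) (insert p τ) hk
  have h2 : vectorSpan ℝ (insert p (τ : Set E)) = ⊤ := by
    rw [← direction_affineSpan, h, AffineSubspace.direction_top]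
  rw [Finset.image_id, Finset.coe_insert, h2, finrank_top] at h1
  have := Finset.card_insert_le p τ
  omega

variable [FiniteDimensional ℝ E]

/-- Every point of the space of a finite complex triangulating the boundary of a convex body lies
in a simplex with at least `dim E` vertices. -/
lemma exists_large_face_mem {P : Set E} (hP : Convex ℝ P) (hint : (interior P).Nonempty)
    (K : Geometry.SimplicialComplex ℝ E) (hfin : K.faces.Finite) (hK : K.space = frontier P)
    {x : E} (hx : x ∈ frontier P) :
    ∃ τ ∈ K.faces, x ∈ convexHull ℝ (τ : Set E) ∧ Module.finrank ℝ E ≤ τ.card := by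
  obtain ⟨p, hp⟩ := hint
  by_contra! hcon
  -- The simplices missing `x` form a closed set, so frontier points near `x` lie only in simplices
  -- of `B`. If those all had fewer than `dim E` vertices, their cones from `p` would cover a
  -- neighbourhood of `x` by finitely many proper affine subspaces, a null set.
  set A : Set (Finset E) := {τ ∈ K.faces | x ∉ convexHull ℝ (τ : Set E)}
  set B : Set (Finset E) := {τ ∈ K.faces | x ∈ convexHull ℝ (τ : Set E)}
  have hA : A.Finite := hfin.subset fun τ h => h.1
  have hB : B.Finite := hfin.subset fun τ h => h.1
  have hclosed : IsClosed (⋃ τ ∈ A, convexHull ℝ (τ : Set E)) :=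
    hA.isClosed_biUnion fun τ _ => τ.finite_toSet.isClosed_convexHull ℝ
  have hU : (⋃ τ ∈ A, convexHull ℝ (τ : Set E))ᶜ ∈ 𝓝 x := by
    refine hclosed.isOpen_compl.mem_nhds ?_
    simp only [Set.mem_compl_iff, Set.mem_iUnion, not_exists]
    exact fun τ hτ => hτ.2
  let _ : MeasurableSpace E := borel E
  have : BorelSpace E := ⟨rfl⟩
  let μ : MeasureTheory.Measure E := MeasureTheory.Measure.addHaar
  have hnull : μ (⋃ τ ∈ B, (affineSpan ℝ (insert p (τ : Set E)) : Set E)) = 0 := by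
    rw [MeasureTheory.measure_biUnion_null_iff hB.countable]
    intro τ hτ
    refine MeasureTheory.Measure.addHaar_affineSubspace μ _ fun h => ?_
    exact (hcon τ hτ.1 hτ.2).not_ge (finrank_le_card_of_affineSpan_insert_eq_top h)
  have hnhds : (⋃ τ ∈ B, (affineSpan ℝ (insert p (τ : Set E)) : Set E)) ∈ 𝓝 x := by
    filter_upwards [eventually_mem_cone_frontier hP hp hx hU] with z hz
    obtain ⟨y, ⟨hyU, hyP⟩, t, rfl⟩ := hz
    rw [← hK] at hyP
    obtain ⟨τ, hτ, hyτ⟩ := Geometry.SimplicialComplex.mem_space_iff.1 hyP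
    have hτB : τ ∈ B := by
      refine ⟨hτ, ?_⟩
      by_contra h
      exact hyU (Set.mem_biUnion (show τ ∈ A from ⟨hτ, h⟩) hyτ)
    refine Set.mem_biUnion hτB (AffineMap.lineMap_mem _ ?_ ?_)
    · exact subset_affineSpan ℝ _ (Set.mem_insert _ _)
    · exact affineSpan_mono ℝ (Set.subset_insert _ _) (convexHull_subset_affineSpan _ hyτ)
  exact (MeasureTheory.Measure.measure_pos_of_mem_nhds μ hnhds).ne' hnull

/-- A simplex with `dim E + 1` vertices has nonempty interior, while the frontier of a closed set
has none. -/
lemma card_le_finrank_of_convexHull_subset_frontier {P : Set E} (hP : IsClosed P) {σ : Finset E}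
    (hσ : AffineIndependent ℝ ((↑) : σ → E)) (h : convexHull ℝ (σ : Set E) ⊆ frontier P) :
    σ.card ≤ Module.finrank ℝ E := by
  have h1 : σ.card ≤ Module.finrank ℝ E + 1 := by
    have := hσ.card_le_finrank_succ
    rw [Fintype.card_coe] at this
    exact this.trans (Nat.succ_le_succ (Submodule.finrank_le _))
  refine Nat.le_of_lt_succ (lt_of_le_of_ne h1 fun h2 => ?_)
  have h3 := (hσ.affineSpan_eq_top_iff_card_eq_finrank_add_one).2 (by rwa [Fintype.card_coe])
  rw [Subtype.range_coe_subtype] at h3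
  have h4 := interior_convexHull_nonempty_iff_affineSpan_eq_top.2 h3
  have h5 := h4.mono (interior_mono h)
  rw [interior_frontier hP] at h5
  exact Set.not_nonempty_empty h5

end Purity

/-! ### Lattice points of dilated unimodular simplices -/

variable {d : ℕ}

lemma mem_integerLattice_nsmul_sum {σ : Finset (Fin d → ℝ)}
    (hσ : (σ : Set (Fin d → ℝ)) ⊆ integerLattice d) (c : (Fin d → ℝ) → ℕ) :
    ∑ v ∈ σ, (c v : ℝ) • v ∈ integerLattice d := by
  refine AddSubgroup.sum_mem _ fun v hv => ?_
  rw [Nat.cast_smul_eq_nsmul]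
  exact AddSubgroup.nsmul_mem _ (hσ hv) _

lemma exists_int_weights_of_mem_edgeLattice {τ : Finset (Fin d → ℝ)} {x : Fin d → ℝ}
    (hx : x ∈ edgeLattice τ) :
    ∃ n : (Fin d → ℝ) → ℤ, ∑ v ∈ τ, n v = 0 ∧ ∑ v ∈ τ, (n v : ℝ) • v = x := by
  classical
  induction hx using AddSubgroup.closure_induction with
  | mem x hx =>
    obtain ⟨v, hv, w, hw, rfl⟩ := hx
    refine ⟨fun u => (if u = v then 1 else 0) - (if u = w then 1 else 0), ?_, ?_⟩
    · simp [hv, hw]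
    · simp [sub_smul, ite_smul, hv, hw]
  | zero => exact ⟨0, by simp, by simp⟩
  | add x y _ _ hx hy =>
    obtain ⟨n, hn, rfl⟩ := hx
    obtain ⟨k, hk, rfl⟩ := hy
    exact ⟨n + k, by simp [Finset.sum_add_distrib, hn, hk],
      by simp [add_smul, Finset.sum_add_distrib]⟩
  | neg x _ hx =>
    obtain ⟨n, hn, rfl⟩ := hx
    exact ⟨-n, by simp [hn], by simp⟩

/-- The lattice points of an integral dilate of a unimodular simplex have integral barycentric
coordinates. -/
lemma exists_int_weights_of_unimodular {τ : Finset (Fin d → ℝ)}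
    (hτ : AffineIndependent ℝ ((↑) : τ → Fin d → ℝ))
    (hlat : (τ : Set (Fin d → ℝ)) ⊆ integerLattice d) (hvol : normalizedVolume τ = 1)
    {m : ℕ} {w : (Fin d → ℝ) → ℝ} (hsum : ∑ v ∈ τ, w v = m)
    (hx : ∑ v ∈ τ, w v • v ∈ integerLattice d) :
    ∀ v ∈ τ, ∃ k : ℤ, w v = k := by
  classical
  intro v₀ hv₀
  -- Subtracting `m` copies of the vertex under scrutiny makes the weights sum to zero, so the
  -- vector is parallel to the simplex; index `1` then places it in the edge lattice.
  have hmem : ∑ v ∈ τ, w v • v - m • v₀ ∈ parallelLattice τ := by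
    refine ⟨AddSubgroup.sub_mem _ hx (AddSubgroup.nsmul_mem _ (hlat hv₀) _), ?_⟩
    have : ∑ v ∈ τ, w v • v - m • v₀ = ∑ v ∈ τ, w v • (v - v₀) := by
      simp only [smul_sub, Finset.sum_sub_distrib]
      rw [← Finset.sum_smul, hsum, Nat.cast_smul_eq_nsmul]
    rw [this]
    exact Submodule.sum_mem _ fun v hv => Submodule.smul_mem _ _ (vsub_mem_vectorSpan ℝ hv hv₀)
  obtain ⟨n, hn0, hn⟩ := exists_int_weights_of_mem_edgeLattice
    (AddSubgroup.relIndex_eq_one.1 hvol hmem)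
  have hn0' : ∑ v ∈ τ, (n v : ℝ) = 0 := by exact_mod_cast hn0
  have key := eq_weights_of_affineIndependent hτ (w := w)
    (w' := fun v => (n v : ℝ) + if v = v₀ then (m : ℝ) else 0) ?_ ?_ v₀ hv₀
  · exact ⟨n v₀ + m, by simp [key]⟩
  · simp [Finset.sum_add_distrib, hn0', hsum, hv₀]
  · simp only [add_smul, ite_smul, zero_smul, Finset.sum_add_distrib, hn, Finset.sum_ite_eq', hv₀,
      if_true, Nat.cast_smul_eq_nsmul]
    abel

/-! ### Triangulations of the boundary -/

lemma convex_of_isFullDim {P : Set (Fin d → ℝ)} (hP : IsFullDimLatticePolytope P) :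
    Convex ℝ P := by
  obtain ⟨V, -, rfl⟩ := hP.lattice
  exact convex_convexHull _ _

lemma isCompact_of_isFullDim {P : Set (Fin d → ℝ)} (hP : IsFullDimLatticePolytope P) :
    IsCompact P := by
  obtain ⟨V, -, rfl⟩ := hP.lattice
  exact V.finite_toSet.isCompact_convexHull ℝ

lemma interior_nonempty_of_isFullDim {P : Set (Fin d → ℝ)} (hP : IsFullDimLatticePolytope P) :
    (interior P).Nonempty :=
  (convex_of_isFullDim hP).interior_nonempty_iff_affineSpan_eq_top.2 hP.affineSpan_eq_top

variable {P : Set (Fin d → ℝ)} {Δ : Geometry.SimplicialComplex ℝ (Fin d → ℝ)}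

lemma card_face_le (hP : IsFullDimLatticePolytope P) (hΔ : IsBoundaryTriangulation P Δ)
    {σ : Finset (Fin d → ℝ)} (hσ : σ ∈ Δ.faces) : σ.card ≤ d := by
  have h := card_le_finrank_of_convexHull_subset_frontier (isCompact_of_isFullDim hP).isClosed
    (Δ.indep hσ) (hΔ.space_eq ▸ Geometry.SimplicialComplex.convexHull_subset_space hσ)
  rwa [Module.finrank_fin_fun] at h

lemma exists_facet_mem (hP : IsFullDimLatticePolytope P) (hΔ : IsBoundaryTriangulation P Δ)
    {x : Fin d → ℝ} (hx : x ∈ frontier P) :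
    ∃ τ ∈ Δ.faces, x ∈ convexHull ℝ (τ : Set (Fin d → ℝ)) ∧ τ.card = d := by
  obtain ⟨τ, hτ, hxτ, hcard⟩ := exists_large_face_mem (convex_of_isFullDim hP)
    (interior_nonempty_of_isFullDim hP) Δ hΔ.finite hΔ.space_eq hx
  rw [Module.finrank_fin_fun] at hcard
  exact ⟨τ, hτ, hxτ, (card_face_le hP hΔ hτ).antisymm hcard⟩

lemma dimSucc_eq (hP : IsFullDimLatticePolytope P) (hΔ : IsBoundaryTriangulation P Δ) :
    dimSucc Δ = d := by
  have hub : ∀ n ∈ Finset.card '' Δ.faces, n ≤ d := by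
    rintro _ ⟨σ, hσ, rfl⟩
    exact card_face_le hP hΔ hσ
  refine le_antisymm (csSup_le' hub) ?_
  -- For `d = 0` the lower bound is trivial; the frontier is then empty and supplies no face.
  rcases Nat.eq_zero_or_pos d with h0 | hpos
  · exact h0.le.trans (Nat.zero_le _)
  have hfr : (frontier P).Nonempty := by
    rw [Set.nonempty_iff_ne_empty]
    intro h
    have : Nonempty (Fin d) := ⟨⟨0, hpos⟩⟩
    rcases frontier_eq_empty_iff.1 h with h | h
    · exact ((interior_nonempty_of_isFullDim hP).mono interior_subset).ne_empty h
    · have := isCompact_of_isFullDim hP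
      rw [h] at this
      exact noncompact_univ (Fin d → ℝ) this
  obtain ⟨x, hx⟩ := hfr
  obtain ⟨τ, hτ, -, hcard⟩ := exists_facet_mem hP hΔ hx
  exact le_csSup ⟨d, hub⟩ ⟨τ, hτ, hcard⟩

lemma frontier_natCast_smul {m : ℕ} (hm : m ≠ 0) (P : Set (Fin d → ℝ)) :
    frontier ((m : ℝ) • P) = (m : ℝ) • frontier P :=
  ((Homeomorph.smulOfNeZero (m : ℝ) (Nat.cast_ne_zero.2 hm)).image_frontier P).symm

/-- The ways to write `m` as a sum of positive integers indexed by `σ`. -/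
def posWeights {ι : Type*} [DecidableEq ι] (σ : Finset ι) (m : ℕ) : Finset (ι →₀ ℕ) :=
  (σ.finsuppAntidiag m).filter fun c => ∀ v ∈ σ, c v ≠ 0

lemma mem_posWeights {ι : Type*} [DecidableEq ι] {σ : Finset ι} {m : ℕ} {c : ι →₀ ℕ} :
    c ∈ posWeights σ m ↔ c.support = σ ∧ ∑ v ∈ σ, c v = m := by
  rw [posWeights, Finset.mem_filter, Finset.mem_finsuppAntidiag]
  constructor
  · rintro ⟨⟨h1, h2⟩, h3⟩
    exact ⟨h2.antisymm fun v hv => Finsupp.mem_support_iff.2 (h3 v hv), h1⟩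
  · rintro ⟨h1, h2⟩
    exact ⟨⟨h2, h1.le⟩, fun v hv => Finsupp.mem_support_iff.1 (h1 ▸ hv)⟩

/-- `X * mk 1` is `z/(1-z) = z + z² + ⋯`, so each vertex of `σ` receives a positive exponent. -/
lemma coeff_X_mul_mk_one_pow {ι : Type*} [DecidableEq ι] (σ : Finset ι) (m : ℕ) :
    PowerSeries.coeff m ((PowerSeries.X * PowerSeries.mk 1 : PowerSeries ℤ) ^ σ.card) =
      (posWeights σ m).card := by
  have hcoeff : ∀ k, PowerSeries.coeff k (PowerSeries.X * PowerSeries.mk 1 : PowerSeries ℤ) =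
      if k ≠ 0 then 1 else 0 := by
    rintro (_ | k)
    · simp
    · simp [PowerSeries.coeff_succ_X_mul]
  rw [← Finset.prod_const, PowerSeries.coeff_prod, posWeights, Finset.card_filter, Nat.cast_sum]
  refine Finset.sum_congr rfl fun c _ => ?_
  simp only [hcoeff]
  rw [Finset.prod_ite_zero]
  simp

/-- Every lattice point of the dilated boundary is a positive integral combination of the vertices
of a unique face. -/
lemma boundaryCount_eq_sum (hP : IsFullDimLatticePolytope P) (hΔ : IsBoundaryTriangulation P Δ)
    (huni : IsUnimodularBoundary Δ) {m : ℕ} (hm : m ≠ 0) :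
    boundaryCount P m = ∑ σ ∈ hΔ.finite.toFinset, (posWeights σ m).card := by
  classical
  have hm' : (m : ℝ) ≠ 0 := Nat.cast_ne_zero.2 hm
  have hm0 : (0 : ℝ) < m := Nat.cast_pos.2 (Nat.pos_of_ne_zero hm)
  have hscale : ∀ (σ : Finset (Fin d → ℝ)) (w : (Fin d → ℝ) → ℝ),
      ∑ v ∈ σ, ((m : ℝ)⁻¹ * w v) • v = (m : ℝ)⁻¹ • ∑ v ∈ σ, w v • v := fun σ w => by
    simp only [mul_smul, Finset.smul_sum]
  have hcast : ∀ {σ : Finset (Fin d → ℝ)} {c : (Fin d → ℝ) →₀ ℕ}, c ∈ posWeights σ m →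
      (∀ v ∈ σ, (0 : ℝ) < (m : ℝ)⁻¹ * c v) ∧ ∑ v ∈ σ, (m : ℝ)⁻¹ * (c v : ℝ) = 1 := by
    intro σ c hc
    obtain ⟨h1, h2⟩ := mem_posWeights.1 hc
    refine ⟨fun v hv => ?_, ?_⟩
    · have : c v ≠ 0 := Finsupp.mem_support_iff.1 (h1 ▸ hv)
      positivity
    · rw [← Finset.mul_sum, ← Nat.cast_sum, h2, inv_mul_cancel₀ hm']
  rw [← Finset.card_sigma, ← Set.ncard_coe_finset, boundaryCount, frontier_natCast_smul hm]
  symm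
  refine Set.ncard_congr (fun s _ => ∑ v ∈ s.1, (s.2 v : ℝ) • v) ?_ ?_ ?_
  · rintro ⟨σ, c⟩ hs
    simp only [Finset.mem_coe, Finset.mem_sigma, Set.Finite.mem_toFinset] at hs
    obtain ⟨hσ, hc⟩ := hs
    refine ⟨?_, mem_integerLattice_nsmul_sum (hΔ.lattice σ hσ) c⟩
    obtain ⟨hpos, hsum⟩ := hcast hc
    rw [Set.mem_smul_set_iff_inv_smul_mem₀ hm', ← hscale, ← hΔ.space_eq]
    exact Geometry.SimplicialComplex.convexHull_subset_space hσ
      (Finset.mem_convexHull'.2 ⟨_, fun v hv => (hpos v hv).le, hsum, rfl⟩)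
  · rintro ⟨σ, c⟩ ⟨ρ, b⟩ hs ht heq
    simp only [Finset.mem_coe, Finset.mem_sigma, Set.Finite.mem_toFinset] at hs ht heq
    obtain ⟨hσ, hc⟩ := hs
    obtain ⟨hρ, hb⟩ := ht
    obtain ⟨hcpos, hcsum⟩ := hcast hc
    obtain ⟨hbpos, hbsum⟩ := hcast hb
    have heq' : ∑ v ∈ σ, ((m : ℝ)⁻¹ * c v) • v = ∑ v ∈ ρ, ((m : ℝ)⁻¹ * b v) • v := by
      rw [hscale, hscale, heq]
    -- The scaled point is relatively interior to both faces, so each contains the other.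
    have h1 : σ ⊆ ρ := face_subset_of_mem_convexHull Δ hσ hρ hcpos hcsum
      (Finset.mem_convexHull'.2 ⟨_, fun v hv => (hbpos v hv).le, hbsum, heq'.symm⟩)
    have h2 : ρ ⊆ σ := face_subset_of_mem_convexHull Δ hρ hσ hbpos hbsum
      (Finset.mem_convexHull'.2 ⟨_, fun v hv => (hcpos v hv).le, hcsum, heq'⟩)
    obtain rfl := h1.antisymm h2
    obtain ⟨hcσ, hcm⟩ := mem_posWeights.1 hc
    obtain ⟨hbσ, hbm⟩ := mem_posWeights.1 hb
    have hw := eq_weights_of_affineIndependent (Δ.indep hσ) (w := fun v => (c v : ℝ))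
      (w' := fun v => (b v : ℝ)) (by exact_mod_cast hcm.trans hbm.symm) heq
    have : c = b := by
      ext v
      by_cases hv : v ∈ σ
      · exact_mod_cast hw v hv
      · rw [Finsupp.notMem_support_iff.1 (hcσ ▸ hv), Finsupp.notMem_support_iff.1 (hbσ ▸ hv)]
    rw [this]
  · rintro y ⟨hyP, hyL⟩
    rw [Set.mem_smul_set_iff_inv_smul_mem₀ hm'] at hyP
    obtain ⟨σ, hσ, w, hpos, hsum, hwx⟩ := exists_face_pos_weights Δ (hΔ.space_eq ▸ hyP)
    obtain ⟨τ, hτ, hxτ, hcard⟩ := exists_facet_mem hP hΔ hyP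
    have hστ : σ ⊆ τ := face_subset_of_mem_convexHull Δ hσ hτ hpos hsum (hwx ▸ hxτ)
    have hy : ∑ v ∈ σ, ((m : ℝ) * w v) • v = y := by
      simp only [mul_smul]
      rw [← Finset.smul_sum, hwx, smul_inv_smul₀ hm']
    have hint : ∀ v ∈ σ, ∃ k : ℤ, (m : ℝ) * w v = k := by
      intro v hv
      -- Unimodularity is available for `τ` only, so the weights on `σ` are extended by zero to `τ`.
      have := exists_int_weights_of_unimodular (Δ.indep hτ) (hΔ.lattice τ hτ) (huni τ hτ hcard)
        (m := m) (w := fun v => if v ∈ σ then (m : ℝ) * w v else 0) ?_ ?_ v (hστ hv)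
      · simpa only [if_pos hv] using this
      · rw [← Finset.sum_filter, Finset.filter_mem_eq_inter, Finset.inter_eq_right.2 hστ,
          ← Finset.mul_sum, hsum, mul_one]
      · simp only [ite_smul, zero_smul]
        rw [← Finset.sum_filter, Finset.filter_mem_eq_inter, Finset.inter_eq_right.2 hστ, hy]
        exact hyL
    have hnat : ∀ v ∈ σ, (⌊(m : ℝ) * w v⌋₊ : ℝ) = (m : ℝ) * w v := by
      intro v hv
      obtain ⟨k, hk⟩ := hint v hv
      have hk0 : (0 : ℝ) ≤ k := hk ▸ (mul_pos hm0 (hpos v hv)).le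
      lift k to ℕ using (by exact_mod_cast hk0)
      rw [hk]
      simp
    let c : (Fin d → ℝ) →₀ ℕ :=
      Finsupp.onFinset σ (fun v => if v ∈ σ then ⌊(m : ℝ) * w v⌋₊ else 0)
        (fun v hv => by by_contra h; simp [h] at hv)
    have hc : ∀ v ∈ σ, (c v : ℝ) = (m : ℝ) * w v := by
      intro v hv
      simpa [c, hv] using hnat v hv
    refine ⟨⟨σ, c⟩, ?_, ?_⟩
    · simp only [Finset.mem_coe, Finset.mem_sigma, Set.Finite.mem_toFinset]
      refine ⟨hσ, mem_posWeights.2 ⟨?_, ?_⟩⟩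
      · refine Finsupp.support_onFinset_subset.antisymm fun v hv => Finsupp.mem_support_iff.2 ?_
        have := mul_pos hm0 (hpos v hv)
        rw [← hc v hv] at this
        exact_mod_cast this.ne'
      · have : ∑ v ∈ σ, (c v : ℝ) = m := by
          rw [Finset.sum_congr rfl hc, ← Finset.mul_sum, hsum, mul_one]
        exact_mod_cast this
    · rw [← hy]
      exact Finset.sum_congr rfl fun v hv => by rw [hc v hv]

/-! ### The generating function -/

lemma boundaryEhrhartSeries_eq (hP : IsFullDimLatticePolytope P)
    (hΔ : IsBoundaryTriangulation P Δ) (huni : IsUnimodularBoundary Δ) :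
    boundaryEhrhartSeries P = 1 + ∑ σ ∈ hΔ.finite.toFinset,
      (PowerSeries.X * PowerSeries.mk 1 : PowerSeries ℤ) ^ σ.card := by
  classical
  ext m
  rw [boundaryEhrhartSeries, PowerSeries.coeff_mk, map_add, map_sum, PowerSeries.coeff_one]
  -- At `m = 0` every face term vanishes because faces are nonempty.
  split_ifs with hm
  · rw [Finset.sum_eq_zero, add_zero]
    intro σ hσ
    have hne : σ.card ≠ 0 := Finset.card_ne_zero.2
      (Geometry.SimplicialComplex.nonempty_of_mem_faces (hΔ.finite.mem_toFinset.1 hσ))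
    subst hm
    simp [hne]
  · rw [zero_add, boundaryCount_eq_sum hP hΔ huni hm, Nat.cast_sum]
    exact Finset.sum_congr rfl fun σ _ => (coeff_X_mul_mk_one_pow σ m).symm

/-- `mk 1` is the inverse of `1 - X`; with `i ≤ d` there are enough factors to cancel all the
denominators. -/
lemma one_sub_X_pow_mul_pow {i : ℕ} (h : i ≤ d) :
    (1 - PowerSeries.X : PowerSeries ℤ) ^ d * (PowerSeries.X * PowerSeries.mk 1) ^ i =
      PowerSeries.X ^ i * (1 - PowerSeries.X) ^ (d - i) := by
  obtain ⟨k, rfl⟩ := Nat.exists_eq_add_of_le h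
  have := PowerSeries.mk_one_mul_one_sub_eq_one ℤ
  rw [Nat.add_sub_cancel_left, pow_add, mul_pow]
  calc _ = (PowerSeries.mk 1 * (1 - PowerSeries.X) : PowerSeries ℤ) ^ i *
        (PowerSeries.X ^ i * (1 - PowerSeries.X) ^ k) := by rw [mul_pow]; ring
    _ = _ := by rw [this, one_pow, one_mul]

/-- The `h`-polynomial as a sum over the faces. -/
lemma hPolynomial_eq_sum_faces (hP : IsFullDimLatticePolytope P)
    (hΔ : IsBoundaryTriangulation P Δ) :
    hPolynomial Δ = (1 - Polynomial.X) ^ d + ∑ σ ∈ hΔ.finite.toFinset,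
      Polynomial.X ^ σ.card * (1 - Polynomial.X) ^ (d - σ.card) := by
  classical
  have hmaps : ∀ σ ∈ hΔ.finite.toFinset, σ.card ∈ Finset.range (d + 1) := fun σ hσ =>
    Finset.mem_range_succ_iff.2 (card_face_le hP hΔ (hΔ.finite.mem_toFinset.1 hσ))
  -- The term `i = 0` is split off on both sides: it is the empty face in `hPolynomial`, and an
  -- empty fibre in the sum over faces.
  rw [hPolynomial, dimSucc_eq hP hΔ, ← Finset.sum_fiberwise_of_maps_to hmaps,
    Finset.sum_range_succ', Finset.sum_range_succ', add_comm, ← add_assoc]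
  have hzero : ∑ σ ∈ hΔ.finite.toFinset with σ.card = 0,
      (Polynomial.X ^ σ.card * (1 - Polynomial.X) ^ (d - σ.card) : Polynomial ℤ) = 0 := by
    rw [Finset.filter_false_of_mem, Finset.sum_empty]
    intro σ hσ
    exact Finset.card_ne_zero.2
      (Geometry.SimplicialComplex.nonempty_of_mem_faces (hΔ.finite.mem_toFinset.1 hσ))
  rw [hzero, add_zero]
  congr 1
  · simp [faceCount]
  · refine Finset.sum_congr rfl fun i _ => ?_
    have hcount : faceCount Δ (i + 1) =
        (hΔ.finite.toFinset.filter fun σ => σ.card = i + 1).card := by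
      rw [faceCount, if_neg (Nat.succ_ne_zero i), ← Set.ncard_coe_finset]
      congr 1
      ext σ
      simp
    rw [hcount, mul_assoc, ← nsmul_eq_mul]
    symm
    refine Finset.sum_eq_card_nsmul fun σ hσ => ?_
    rw [(Finset.mem_filter.1 hσ).2]

end BoundaryEhrhart

theorem mainTheorem2 {d : ℕ} (P : Set (Fin d → ℝ))
    (hP : BoundaryEhrhart.IsFullDimLatticePolytope P)
    (Δ : Geometry.SimplicialComplex ℝ (Fin d → ℝ))
    (hΔ : BoundaryEhrhart.IsBoundaryTriangulation P Δ)
    (hreg : BoundaryEhrhart.IsRegularBoundary P Δ)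
    (huni : BoundaryEhrhart.IsUnimodularBoundary Δ) :
    BoundaryEhrhart.boundaryHStar P = (BoundaryEhrhart.hPolynomial Δ : PowerSeries ℤ) := by
  classical
  rw [BoundaryEhrhart.boundaryHStar, BoundaryEhrhart.boundaryEhrhartSeries_eq hP hΔ huni,
    BoundaryEhrhart.hPolynomial_eq_sum_faces hP hΔ, mul_add, mul_one, Finset.mul_sum,
    ← Polynomial.coeToPowerSeries.ringHom_apply, map_add, map_sum]
  simp only [map_mul, map_pow, map_sub, map_one, Polynomial.coeToPowerSeries.ringHom_apply,
    Polynomial.coe_X]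
  congr 1
  exact Finset.sum_congr rfl fun σ hσ => BoundaryEhrhart.one_sub_X_pow_mul_pow
    (BoundaryEhrhart.card_face_le hP hΔ (hΔ.finite.mem_toFinset.1 hσ))
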